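/- Let $\Omega\subset\mathbb{R}^2$ be a non-empty connected open set (for instance a bounded Lipschitz domain), let $a\in(0,1]$ and $\theta\in\mathbb{R}$, let $h\ge 1$ be an integer and let $\lambda=(\lambda_0,\dots,\lambda_{h-1})$ with all $\lambda_l>0$. Let $$E^{a,\theta}=\Big\{x\in\mathbb{R}^2 : (x_1\cos\theta+x_2\sin\theta)^2+\Big(\frac{-x_1\sin\theta+x_2\cos\theta}{a}\Big)^2\le 1\Big\}.$$ Write $\mathrm{Sym}^m(\mathbb{R}^2)$ for the space of symmetric $m$-linear forms $\xi$ on $\mathbb{R}^2$ and, for a multi-index $\beta\in\mathbb{N}^2$ with $|\beta|=m$, $\xi_\beta=\xi(e_1,\dots,e_1,e_2,\dots,e_2)$ with $e_i$ occurring $\beta_i$ times. For $m\ge1$ let $E^{a,\theta}_{m}\subset\mathrm{Sym}^m(\mathbb{R}^2)$ be the set of all $\xi$ such that for every $i\in\{1,\dots,m\}$ and $p\in\{1,2\}^m$ the linear form $\xi(e_{p_1},\dots,e_{p_{i-1}},\,\cdot\,,e_{p_{i+1}},\dots,e_{p_m})$, identified with the vector of its values at $e_1$ and $e_2$, belongs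 to $E^{a,\theta}$. For $\eta\in C^h_c(\Omega,\mathrm{Sym}^h(\mathbb{R}^2))$ and $0\le l\le h$ let $\mathrm{div}^l\eta$ be the field of symmetric $(h-l)$-tensors with components $$(\mathrm{div}^l\eta(x))_\beta=\sum_{|\gamma|=l}\frac{l!}{\gamma!}\,\frac{\partial^l\eta_{\beta+\gamma}}{\partial x^\gamma}(x),\qquad |\beta|=h-l .$$ For $u\in L^1(\Omega)$ the directional total generalized variation of order $h$ is $$\mathrm{DTGV}^h_\lambda(u)=\sup\Big\{\int_\Omega u\,\mathrm{div}^h\eta\,dx : \eta\in C^h_c(\Omega,\mathrm{Sym}^h(\mathbb{R}^2)),\ \mathrm{div}^l\eta(x)\in\lambda_l E^{a,\theta}_{h-l}\ \ \forall x\in\Omega,\ l=0,\dots,h-1\Big\}\in[0,\infty].$$ Then for every $u\in L^1(\Omega)$: $\mathrm{DTGV}^h_\lambda(u)=0$ if and only if $u$ coincides almost everywhere on $\Omega$ with a polynomial of degree less than $h$. -/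

import Mathlib

open MeasureTheory
open scoped Pointwise Nat

noncomputable section

namespace DTGV

/-- The Euclidean plane. -/
abbrev Plane : Type := EuclideanSpace ℝ (Fin 2)

/-- The standard basis vectors `e 0 = (1, 0)` and `e 1 = (0, 1)` of the plane. -/
def e (i : Fin 2) : Plane := EuclideanSpace.single i (1 : ℝ)

/-- `Sym^m(ℝ²)`: the symmetric `m`-linear forms on the plane. -/
def SymTensor (m : ℕ) : Submodule ℝ (ContinuousMultilinearMap ℝ (fun _ : Fin m => Plane) ℝ) where
  carrier := {ξ | ∀ (σ : Equiv.Perm (Fin m)) (v : Fin m → Plane), ξ (fun i => v (σ i)) = ξ v}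
  add_mem' := by
    intro ξ ζ hξ hζ σ v
    simp only [add_apply, hξ σ v, hζ σ v]
  zero_mem' := by
    intro σ v
    rfl
  smul_mem' := by
    intro c ξ hξ σ v
    simp only [smul_apply, hξ σ v]

/-- The component `ξ_β = ξ(e₁, …, e₁, e₂, …, e₂)` of a symmetric `m`-tensor, where `e₁` occurs
`β.1` times and `e₂` occurs `β.2` times; it is only used for multi-indices with `β.1 + β.2 = m`. -/
def comp {m : ℕ} (ξ : SymTensor m) (β : ℕ × ℕ) : ℝ :=
  ξ.1 (fun i : Fin m => if (i : ℕ) < β.1 then e 0 else e 1)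

/-- The multi-index of `(e_{p 1}, …, e_{p m})`: how often `e₁` and `e₂` occur. -/
def countIndex {m : ℕ} (p : Fin m → Fin 2) : ℕ × ℕ :=
  ((Finset.univ.filter fun i => p i = 0).card, (Finset.univ.filter fun i => p i = 1).card)

/-- The symmetric `m`-tensor with prescribed components `c β`, `β.1 + β.2 = m`:
`ξ(v₁, …, v_m) = ∑_p c_{β(p)} ∏_i (v_i)_{p i}`, the sum being over `p ∈ {1, 2}^m`. -/
def ofComp (m : ℕ) (c : ℕ × ℕ → ℝ) : SymTensor m :=
  ⟨∑ p : Fin m → Fin 2, c (countIndex p) •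
      (ContinuousMultilinearMap.mkPiAlgebra ℝ (Fin m) ℝ).compContinuousLinearMap
        (fun i => (EuclideanSpace.proj (p i) : Plane →L[ℝ] ℝ)), by
    intro σ v
    simp only [sum_apply, smul_apply,
      ContinuousMultilinearMap.compContinuousLinearMap_apply,
      ContinuousMultilinearMap.mkPiAlgebra_apply, PiLp.proj_apply, smul_eq_mul]
    refine Fintype.sum_equiv (Equiv.arrowCongr σ (Equiv.refl (Fin 2))) _ _ fun p => ?_
    have hcount : countIndex (Equiv.arrowCongr σ (Equiv.refl (Fin 2)) p) = countIndex p := by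
      have key : ∀ j : Fin 2,
          (Finset.univ.filter fun i => Equiv.arrowCongr σ (Equiv.refl (Fin 2)) p i = j).card =
            (Finset.univ.filter fun i => p i = j).card := fun j =>
        Finset.card_equiv σ.symm (by intro i; simp)
      simp only [countIndex, key]
    rw [hcount]
    congr 1
    refine Fintype.prod_equiv σ _ _ fun i => ?_
    simp [Equiv.arrowCongr_apply]⟩

/-- The partial derivative `∂f/∂x_i`. -/
def pderiv (i : Fin 2) (f : Plane → ℝ) : Plane → ℝ := fun x => fderiv ℝ f x (e i)

/-- The iterated partial derivative `∂^{|γ|} f / ∂x^γ`. -/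
def pderivIter (γ : ℕ × ℕ) (f : Plane → ℝ) : Plane → ℝ :=
  (pderiv 0)^[γ.1] ((pderiv 1)^[γ.2] f)

/-- The component `(div^l η(x))_β = ∑_{|γ| = l} (l! / γ!) ∂^l η_{β + γ} / ∂x^γ (x)` of the
`l`-fold divergence of a field of symmetric `h`-tensors, for `|β| = h - l`. -/
def divComp {h : ℕ} (l : ℕ) (η : Plane → SymTensor h) (β : ℕ × ℕ) (x : Plane) : ℝ :=
  ∑ γ ∈ Finset.HasAntidiagonal.antidiagonal l,
    ((l ! : ℝ) / ((γ.1 ! : ℝ) * (γ.2 ! : ℝ))) * pderivIter γ (fun y => comp (η y) (β + γ)) x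

/-- The `l`-fold divergence (`l ≤ h`) of a field of symmetric `h`-tensors, a field of symmetric
`(h - l)`-tensors. -/
def div {h : ℕ} (l : ℕ) (η : Plane → SymTensor h) (x : Plane) : SymTensor (h - l) :=
  ofComp (h - l) (fun β => divComp l η β x)

/-- The closed elliptical set centered at the origin with major semi-axis `1` in the direction
`(cos θ, sin θ)` and minor semi-axis `a`. -/
def ellipse (a θ : ℝ) : Set Plane :=
  {x | ((x 0 * Real.cos θ + x 1 * Real.sin θ) / 1) ^ 2 +
      ((-x 0 * Real.sin θ + x 1 * Real.cos θ) / a) ^ 2 ≤ 1}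

/-- The symmetric `m`-tensors `ξ` all of whose sections
`ξ(e_{p 1}, …, e_{p (i-1)}, ·, e_{p (i+1)}, …, e_{p m})`, read as vectors of the plane, belong to
the elliptical set. -/
def tensorEllipse (a θ : ℝ) (m : ℕ) : Set (SymTensor m) :=
  {ξ | ∀ (i : Fin m) (p : Fin m → Fin 2),
    !₂[ξ.1 (Function.update (fun j => e (p j)) i (e 0)),
       ξ.1 (Function.update (fun j => e (p j)) i (e 1))] ∈ ellipse a θ}

/-- The feasible test fields: `η ∈ C^h_c(Ω, Sym^h(ℝ²))` (extended by zero to the plane) with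
`div^l η(x) ∈ λ_l E^{a,θ}_{2×…×2}(0)` (`h - l` times) for all `x ∈ Ω` and `l = 0, …, h - 1`. -/
def feasible (Ω : Set Plane) (a θ : ℝ) {h : ℕ} (lam : Fin h → ℝ) : Set (Plane → SymTensor h) :=
  {η | ContDiff ℝ h η ∧ HasCompactSupport η ∧ tsupport η ⊆ Ω ∧
    ∀ x ∈ Ω, ∀ l : Fin h, div l η x ∈ lam l • tensorEllipse a θ (h - l)}

/-- The directional total generalized variation of order `h` with weights `lam`, as an extended
real number. The scalar field `div^h η` is the component of index `(0, 0)`. -/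
def dtgv (Ω : Set Plane) (a θ : ℝ) {h : ℕ} (lam : Fin h → ℝ) (u : Plane → ℝ) : EReal :=
  ⨆ η ∈ feasible Ω a θ lam, ((∫ x in Ω, u x * divComp h η (0, 0) x : ℝ) : EReal)

end DTGV

end

namespace DTGV

open scoped ContDiff
open Set

/-! ### Iterated partial derivatives -/

/-! The kernel is computed by translating a vanishing supremum into the vanishing of all weak
derivatives of order `h`.

If the supremum is 0, take a scalar test function `f` and a tensor whose single nonzero component
has index `γ`. Each set of tensors bounding `div^l η` contains a neighbourhood of 0, so `t f` times
this tensor is feasible for every small `t` of either sign (`eventually_smul_mem_feasible`). Its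
`h`-fold divergence is a positive multiple of `t ∂^γ f`; both signs of `t` force `∫ u ∂^γ f = 0`
(`weakDerivZero_of_dtgv_eq_zero`).

A function with this property is a polynomial of degree less than `h`. Near a point of `Ω` its
mollifications have zero classical derivatives of order `h`, hence are such polynomials on a ball;
these form a finite-dimensional, hence closed, space, so the almost everywhere limit is one too
(`WeakDerivZero.exists_ball`). Polynomials agreeing on an open set are equal, and connectedness
glues the local ones (`WeakDerivZero.exists_polyLT`).

Conversely, `h` integrations by parts against a polynomial of degree less than `h` give 0 for every
feasible field (`integral_mul_divComp_eq_zero`). -/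

theorem pderivIter_zero (f : Plane → ℝ) : pderivIter (0, 0) f = f := rfl

theorem pderivIter_succ_left (a b : ℕ) (f : Plane → ℝ) :
    pderivIter (a + 1, b) f = pderiv 0 (pderivIter (a, b) f) :=
  Function.iterate_succ_apply' _ _ _

theorem pderivIter_zero_succ (b : ℕ) (f : Plane → ℝ) :
    pderivIter (0, b + 1) f = pderiv 1 (pderivIter (0, b) f) :=
  Function.iterate_succ_apply' _ _ _

/-- A multi-index of order `n + 1` has an outermost partial derivative. -/
theorem exists_pderivIter_eq {n : ℕ} {γ : ℕ × ℕ} (hγ : γ.1 + γ.2 = n + 1) :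
    ∃ (i : Fin 2) (δ : ℕ × ℕ), δ.1 + δ.2 = n ∧
      ∀ f : Plane → ℝ, pderivIter γ f = pderiv i (pderivIter δ f) := by
  obtain ⟨_ | a, b⟩ := γ
  · obtain rfl : b = n + 1 := by simpa using hγ
    exact ⟨1, (0, n), by simp, pderivIter_zero_succ n⟩
  · exact ⟨0, (a, b), by simp at hγ ⊢; omega, pderivIter_succ_left a b⟩

theorem pderivIter_induction {C : (Plane → ℝ) → Prop} (hC : ∀ i g, C g → C (pderiv i g))
    {f : Plane → ℝ} (hf : C f) (γ : ℕ × ℕ) : C (pderivIter γ f) := by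
  have key : ∀ (i : Fin 2) (k : ℕ) (g : Plane → ℝ), C g → C ((pderiv i)^[k] g) := by
    intro i k g hg
    induction k with
    | zero => exact hg
    | succ k ih => rw [Function.iterate_succ_apply']; exact hC _ _ ih
  exact key _ _ _ (key _ _ _ hf)

theorem contDiff_pderiv {n : ℕ} {f : Plane → ℝ} (hf : ContDiff ℝ (n + 1 : ℕ) f) (i : Fin 2) :
    ContDiff ℝ n (pderiv i f) :=
  (hf.fderiv_right (by norm_cast)).clm_apply contDiff_const

theorem contDiff_pderivIter {k n : ℕ} {γ : ℕ × ℕ} (hγ : γ.1 + γ.2 = n) {f : Plane → ℝ}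
    (hf : ContDiff ℝ (k + n : ℕ) f) : ContDiff ℝ k (pderivIter γ f) := by
  induction n generalizing k γ with
  | zero =>
    obtain ⟨h1, h2⟩ : γ.1 = 0 ∧ γ.2 = 0 := by omega
    obtain rfl : γ = (0, 0) := Prod.ext h1 h2
    simpa [pderivIter_zero] using hf
  | succ n ih =>
    obtain ⟨i, δ, hδ, h⟩ := exists_pderivIter_eq hγ
    rw [h]
    exact contDiff_pderiv (ih hδ (by rwa [show k + 1 + n = k + (n + 1) by ring])) i

theorem contDiff_infty_pderiv (i : Fin 2) (f : Plane → ℝ) (hf : ContDiff ℝ ∞ f) :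
    ContDiff ℝ ∞ (pderiv i f) :=
  (hf.fderiv_right (by norm_cast)).clm_apply contDiff_const

theorem contDiff_infty_pderivIter {f : Plane → ℝ} (hf : ContDiff ℝ ∞ f) (γ : ℕ × ℕ) :
    ContDiff ℝ ∞ (pderivIter γ f) :=
  pderivIter_induction contDiff_infty_pderiv hf γ

theorem tsupport_pderiv_subset (i : Fin 2) (f : Plane → ℝ) :
    tsupport (pderiv i f) ⊆ tsupport f := by
  refine closure_minimal (fun x hx => ?_) (isClosed_tsupport f)
  by_contra h
  refine hx ?_
  have : fderiv ℝ f x = 0 := by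
    by_contra h'
    exact h (support_fderiv_subset ℝ h')
  simp [pderiv, this]

theorem tsupport_pderivIter_subset (γ : ℕ × ℕ) (f : Plane → ℝ) :
    tsupport (pderivIter γ f) ⊆ tsupport f :=
  pderivIter_induction (C := fun g => tsupport g ⊆ tsupport f)
    (fun i g hg => (tsupport_pderiv_subset i g).trans hg) subset_rfl γ

theorem hasCompactSupport_pderivIter {f : Plane → ℝ} (hf : HasCompactSupport f) (γ : ℕ × ℕ) :
    HasCompactSupport (pderivIter γ f) :=
  hf.mono' ((subset_tsupport _).trans (tsupport_pderivIter_subset γ f))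

theorem pderiv_const_smul (i : Fin 2) (c : ℝ) (f : Plane → ℝ) :
    pderiv i (c • f) = c • pderiv i f := by
  ext x
  simp [pderiv, fderiv_const_smul_field]

theorem pderivIter_const_smul (γ : ℕ × ℕ) (c : ℝ) (f : Plane → ℝ) :
    pderivIter γ (c • f) = c • pderivIter γ f := by
  have key : ∀ (i : Fin 2) (k : ℕ) (g : Plane → ℝ),
      (pderiv i)^[k] (c • g) = c • (pderiv i)^[k] g := by
    intro i k g
    induction k with
    | zero => rfl
    | succ k ih => rw [Function.iterate_succ_apply', ih, pderiv_const_smul,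
        Function.iterate_succ_apply']
  rw [pderivIter, key, key, ← pderivIter]

/-- An operator that commutes with partial derivatives up to a constant factor does so with
iterated partial derivatives. -/
theorem pderivIter_comm_of {C : (Plane → ℝ) → Prop} (hC : ∀ i g, C g → C (pderiv i g))
    (T : (Plane → ℝ) → (Plane → ℝ)) (c : ℝ)
    (hT : ∀ i g, C g → pderiv i (T g) = c • T (pderiv i g))
    {n : ℕ} {γ : ℕ × ℕ} (hγ : γ.1 + γ.2 = n) {f : Plane → ℝ} (hf : C f) :
    pderivIter γ (T f) = c ^ n • T (pderivIter γ f) := by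
  induction n generalizing γ with
  | zero =>
    obtain ⟨h1, h2⟩ : γ.1 = 0 ∧ γ.2 = 0 := by omega
    obtain rfl : γ = (0, 0) := Prod.ext h1 h2
    simp [pderivIter_zero]
  | succ n ih =>
    obtain ⟨i, δ, hδ, h⟩ := exists_pderivIter_eq hγ
    rw [h, h, ih hδ, pderiv_const_smul, hT i _ (pderivIter_induction hC hf δ), smul_smul, pow_succ]

theorem pderiv_sub (i : Fin 2) {f g : Plane → ℝ} (hf : Differentiable ℝ f)
    (hg : Differentiable ℝ g) : pderiv i (f - g) = pderiv i f - pderiv i g := by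
  ext x
  simp [pderiv, fderiv_sub (hf x) (hg x)]

theorem pderivIter_sub (γ : ℕ × ℕ) {f g : Plane → ℝ} (hf : ContDiff ℝ ∞ f)
    (hg : ContDiff ℝ ∞ g) : pderivIter γ (f - g) = pderivIter γ f - pderivIter γ g := by
  generalize hn : γ.1 + γ.2 = n
  induction n generalizing γ with
  | zero =>
    obtain ⟨h1, h2⟩ : γ.1 = 0 ∧ γ.2 = 0 := by omega
    obtain rfl : γ = (0, 0) := Prod.ext h1 h2
    simp [pderivIter_zero]
  | succ n ih =>
    obtain ⟨i, δ, hδ, h⟩ := exists_pderivIter_eq hn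
    rw [h, h, h, ih δ hδ, pderiv_sub]
    · exact (contDiff_infty_pderivIter hf δ).differentiable (by simp)
    · exact (contDiff_infty_pderivIter hg δ).differentiable (by simp)

theorem pderiv_comm (i j : Fin 2) {f : Plane → ℝ} (hf : ContDiff ℝ ∞ f) :
    pderiv i (pderiv j f) = pderiv j (pderiv i f) := by
  have hd : Differentiable ℝ (fderiv ℝ f) :=
    (hf.fderiv_right (m := ∞) (by norm_cast)).differentiable (by simp)
  have h : ∀ (i j : Fin 2) x, pderiv i (pderiv j f) x = fderiv ℝ (fderiv ℝ f) x (e i) (e j) := by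
    intro i j x
    have := ((hd x).hasFDerivAt.clm_apply (hasFDerivAt_const (e j) x)).fderiv
    change fderiv ℝ (fun y => fderiv ℝ f y (e j)) x (e i) = _
    rw [this]
    simp
  ext x
  rw [h, h]
  exact (hf.contDiffAt.isSymmSndFDerivAt (by simp [minSmoothness_of_isRCLikeNormedField]; norm_cast)).eq _ _

/-- `pderivIter` applies the second-coordinate derivatives innermost, so a further one has to be
moved past the others by symmetry of second derivatives. -/
theorem pderiv_one_pderivIter (a b : ℕ) {f : Plane → ℝ} (hf : ContDiff ℝ ∞ f) :
    pderiv 1 (pderivIter (a, b) f) = pderivIter (a, b + 1) f := by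
  induction a with
  | zero => exact (pderivIter_zero_succ b f).symm
  | succ a ih =>
    rw [pderivIter_succ_left, pderivIter_succ_left, ← ih,
      pderiv_comm _ _ (contDiff_infty_pderivIter hf _)]

theorem fderiv_eq_zero_of_pderiv {f : Plane → ℝ} {x : Plane} (h : ∀ i, pderiv i f x = 0) :
    fderiv ℝ f x = 0 := by
  ext v
  have hv : v = v 0 • e 0 + v 1 • e 1 := by
    ext i; fin_cases i <;> simp [e]
  rw [hv, map_add, map_smul, map_smul]
  simp [show fderiv ℝ f x (e 0) = 0 from h 0, show fderiv ℝ f x (e 1) = 0 from h 1]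

/-! ### Polynomial functions on the plane -/

/-- The function on the plane defined by a polynomial. -/
noncomputable def polyFun (P : MvPolynomial (Fin 2) ℝ) : Plane → ℝ := fun x => MvPolynomial.eval (fun i => x i) P

/-- The polynomials of total degree less than `n`; only the zero polynomial if `n = 0`. -/
noncomputable def polyLT (n : ℕ) : Submodule ℝ (MvPolynomial (Fin 2) ℝ) where
  carrier := {P | ∀ m : Fin 2 →₀ ℕ, n ≤ m.degree → P.coeff m = 0}
  add_mem' := by
    intro P Q hP hQ m hm
    simp [hP m hm, hQ m hm]
  zero_mem' := by
    intro m _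
    simp
  smul_mem' := by
    intro c P hP m hm
    simp [hP m hm]

theorem mem_polyLT {n : ℕ} {P : MvPolynomial (Fin 2) ℝ} :
    P ∈ polyLT n ↔ ∀ m : Fin 2 →₀ ℕ, n ≤ m.degree → P.coeff m = 0 := Iff.rfl

theorem polyLT_zero {P : MvPolynomial (Fin 2) ℝ} (hP : P ∈ polyLT 0) : P = 0 :=
  MvPolynomial.ext _ _ fun m => by simpa using hP m (Nat.zero_le _)

theorem polyLT_mono {m n : ℕ} (h : m ≤ n) : polyLT m ≤ polyLT n :=
  fun _ hP k hk => hP k (h.trans hk)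

theorem mem_polyLT_succ_iff {n : ℕ} {P : MvPolynomial (Fin 2) ℝ} :
    P ∈ polyLT (n + 1) ↔ P.totalDegree ≤ n := by
  rw [mem_polyLT, MvPolynomial.totalDegree, Finset.sup_le_iff]
  refine forall_congr' fun m => ?_
  rw [MvPolynomial.mem_support_iff]
  change _ ↔ (_ → m.degree ≤ n)
  rw [Nat.succ_le_iff, ← not_imp_not, not_lt]

theorem finiteDimensional_polyLT (n : ℕ) : FiniteDimensional ℝ (polyLT (n + 1)) := by
  have : polyLT (n + 1) ≤ MvPolynomial.restrictTotalDegree (Fin 2) ℝ n := fun P hP =>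
    (MvPolynomial.mem_restrictTotalDegree _ _ _).2 (mem_polyLT_succ_iff.1 hP)
  exact Submodule.finiteDimensional_of_le this

theorem pderiv_mem_polyLT {n : ℕ} {P : MvPolynomial (Fin 2) ℝ} (hP : P ∈ polyLT (n + 1))
    (i : Fin 2) : MvPolynomial.pderiv i P ∈ polyLT n := by
  intro m hm
  rw [MvPolynomial.coeff_pderiv, hP _ (by simpa using hm)]
  simp

theorem hasFDerivAt_coord (i : Fin 2) (x : Plane) :
    HasFDerivAt (𝕜 := ℝ) (fun y : Plane => y i) (EuclideanSpace.proj i : Plane →L[ℝ] ℝ) x :=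
  (EuclideanSpace.proj i : Plane →L[ℝ] ℝ).hasFDerivAt

theorem contDiff_polyFun (P : MvPolynomial (Fin 2) ℝ) : ContDiff ℝ ∞ (polyFun P) := by
  induction P using MvPolynomial.induction_on with
  | C c =>
    have : polyFun (MvPolynomial.C c) = fun _ => c := by ext; simp [polyFun]
    rw [this]; exact contDiff_const
  | add P Q hP hQ =>
    have : polyFun (P + Q) = polyFun P + polyFun Q := by ext; simp [polyFun]
    rw [this]; exact hP.add hQ
  | mul_X P i hP =>
    have : polyFun (P * MvPolynomial.X i) = polyFun P * fun x => x i := by ext; simp [polyFun]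
    rw [this]
    exact hP.mul (EuclideanSpace.proj i : Plane →L[ℝ] ℝ).contDiff

theorem pderiv_polyFun (i : Fin 2) (P : MvPolynomial (Fin 2) ℝ) :
    pderiv i (polyFun P) = polyFun (MvPolynomial.pderiv i P) := by
  have hd : ∀ Q x, DifferentiableAt ℝ (polyFun Q) x := fun Q x =>
    (contDiff_polyFun Q).differentiable (by simp) x
  induction P using MvPolynomial.induction_on with
  | C c =>
    have : polyFun (MvPolynomial.C c) = fun _ => c := by ext; simp [polyFun]
    ext x; simp [this, pderiv]; simp [polyFun]
  | add P Q hP hQ =>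
    have : polyFun (P + Q) = polyFun P + polyFun Q := by ext; simp [polyFun]
    ext x
    rw [this, pderiv, fderiv_add (hd P x) (hd Q x)]
    have h1 := congrFun hP x
    have h2 := congrFun hQ x
    simp only [pderiv] at h1 h2
    simp [h1, h2, polyFun]
  | mul_X P j hP =>
    have : polyFun (P * MvPolynomial.X j) = polyFun P * fun x => x j := by ext; simp [polyFun]
    ext x
    have h1 := congrFun hP x
    simp only [pderiv] at h1
    rw [this, pderiv, ((hd P x).hasFDerivAt.mul (hasFDerivAt_coord j x)).fderiv]
    have h2 : (e i : Plane) j = if j = i then 1 else 0 := by simp [e]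
    rw [add_apply, smul_apply, smul_apply, h1, PiLp.proj_apply, h2]
    simp only [polyFun, smul_eq_mul, MvPolynomial.pderiv_mul, MvPolynomial.pderiv_X,
      Pi.single_apply, map_add, map_mul, MvPolynomial.eval_X]
    split_ifs <;> simp <;> ring

theorem pderivIter_polyFun (γ : ℕ × ℕ) (P : MvPolynomial (Fin 2) ℝ) :
    pderivIter γ (polyFun P) =
      polyFun ((MvPolynomial.pderiv 0)^[γ.1] ((MvPolynomial.pderiv 1)^[γ.2] P)) := by
  have key : ∀ (i : Fin 2) (k : ℕ) Q,
      (pderiv i)^[k] (polyFun Q) = polyFun ((MvPolynomial.pderiv i)^[k] Q) := by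
    intro i k Q
    induction k with
    | zero => rfl
    | succ k ih =>
      rw [Function.iterate_succ_apply', ih, pderiv_polyFun, Function.iterate_succ_apply']
  rw [pderivIter, key, key]

theorem iterate_pderiv_monomial (i : Fin 2) (k : ℕ) (s : Fin 2 →₀ ℕ) (c : ℝ) :
    (MvPolynomial.pderiv i)^[k] (MvPolynomial.monomial s c) =
      MvPolynomial.monomial (s - Finsupp.single i k) (c * (s i).descFactorial k) := by
  induction k with
  | zero => simp
  | succ k ih =>
    rw [Function.iterate_succ_apply', ih, MvPolynomial.pderiv_monomial, tsub_tsub,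
      ← Finsupp.single_add, Nat.descFactorial_succ]
    congr 1
    simp
    ring

/-- The multi-index `γ` as a finitely supported function. -/
noncomputable def expo (γ : ℕ × ℕ) : Fin 2 →₀ ℕ := Finsupp.single 0 γ.1 + Finsupp.single 1 γ.2

/-- Monomials and derivatives of the same order are dual up to factorials, which lets a homogeneous
polynomial be prescribed by its top-order derivatives. -/
theorem pderivIter_polyFun_monomial {γ δ : ℕ × ℕ} (h : γ.1 + γ.2 = δ.1 + δ.2) (c : ℝ) (x : Plane) :
    pderivIter γ (polyFun (MvPolynomial.monomial (expo δ) c)) x =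
      if δ = γ then c * (γ.1 ! * γ.2 !) else 0 := by
  rw [pderivIter_polyFun, iterate_pderiv_monomial, iterate_pderiv_monomial]
  split_ifs with hδ
  · subst hδ
    simp [expo, polyFun, Nat.descFactorial_self]
    ring
  -- Equal orders and distinct indices: one variable is differentiated more often than it occurs.
  · have : δ.2 < γ.2 ∨ δ.1 < γ.1 := by
      by_contra hc
      exact hδ (Prod.ext (by omega) (by omega))
    rcases this with h | h <;>
    simp [expo, polyFun, Nat.descFactorial_of_lt h]

/-- A smooth function whose partial derivatives of order `n` vanish on a ball is there a polynomial
of degree less than `n`. -/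
theorem exists_polyLT_of_pderivIter_eq_zero (c : Plane) (r : ℝ) (hr : 0 < r) (n : ℕ)
    {f : Plane → ℝ} (hf : ContDiff ℝ ∞ f)
    (h : ∀ γ : ℕ × ℕ, γ.1 + γ.2 = n → ∀ x ∈ Metric.ball c r, pderivIter γ f x = 0) :
    ∃ P ∈ polyLT n, ∀ x ∈ Metric.ball c r, f x = polyFun P x := by
  induction n generalizing f with
  | zero => exact ⟨0, zero_mem _, fun x hx => by
      simpa [polyFun, pderivIter_zero] using h (0, 0) rfl x hx⟩
  | succ n ih =>
    -- The gradient of an order-`n` derivative consists of order-`n + 1` derivatives, which vanish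
    -- on the connected ball.
    have hconst : ∀ γ : ℕ × ℕ, γ.1 + γ.2 = n → ∀ x ∈ Metric.ball c r,
        pderivIter γ f x = pderivIter γ f c := by
      intro γ hγ x hx
      refine Metric.isOpen_ball.is_const_of_fderiv_eq_zero (𝕜 := ℝ)
        (convex_ball c r).isPreconnected
        ((contDiff_infty_pderivIter hf γ).differentiable (by simp)).differentiableOn
        (fun y hy => fderiv_eq_zero_of_pderiv fun i => ?_) hx (Metric.mem_ball_self hr)
      fin_cases i
      · exact (congrFun (pderivIter_succ_left γ.1 γ.2 f) y).symm.trans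
          (h (γ.1 + 1, γ.2) (by simp; omega) y hy)
      · exact (congrFun (pderiv_one_pderivIter γ.1 γ.2 hf) y).trans
          (h (γ.1, γ.2 + 1) (by simp; omega) y hy)
    -- The homogeneous Taylor part of degree `n` at `c`; subtracting it kills the constant order-`n`
    -- derivatives, so the induction hypothesis applies to `f - P`.
    set P : MvPolynomial (Fin 2) ℝ := ∑ δ ∈ Finset.HasAntidiagonal.antidiagonal n,
      MvPolynomial.monomial (expo δ) (pderivIter δ f c / (δ.1 ! * δ.2 !)) with hP
    have hPmem : P ∈ polyLT (n + 1) := by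
      refine Submodule.sum_mem _ fun δ hδ m hm => ?_
      rw [Finset.HasAntidiagonal.mem_antidiagonal] at hδ
      rw [MvPolynomial.coeff_monomial, if_neg]
      rintro rfl
      simp [expo] at hm
      omega
    have hPder : ∀ γ : ℕ × ℕ, γ.1 + γ.2 = n → ∀ x, pderivIter γ (polyFun P) x =
        pderivIter γ f c := by
      intro γ hγ x
      have hiter : ∀ (i : Fin 2) (k : ℕ) (s : Finset (ℕ × ℕ)) (g : ℕ × ℕ → MvPolynomial (Fin 2) ℝ),
          (MvPolynomial.pderiv i)^[k] (∑ δ ∈ s, g δ) =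
            ∑ δ ∈ s, (MvPolynomial.pderiv i)^[k] (g δ) := fun i k s g => by
        have hk : ⇑((MvPolynomial.pderiv (R := ℝ) i).toLinearMap ^ k) =
            (MvPolynomial.pderiv i)^[k] := Module.End.coe_pow _ _
        rw [← hk, map_sum]
      have hsum : pderivIter γ (polyFun P) x = ∑ δ ∈ Finset.HasAntidiagonal.antidiagonal n,
          pderivIter γ (polyFun (MvPolynomial.monomial (expo δ)
            (pderivIter δ f c / (δ.1 ! * δ.2 !)))) x := by
        simp_rw [pderivIter_polyFun, hP, hiter, polyFun, map_sum]
      rw [hsum, Finset.sum_congr rfl fun δ hδ => pderivIter_polyFun_monomial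
        (hγ.trans (Finset.HasAntidiagonal.mem_antidiagonal.1 hδ).symm) _ x, Finset.sum_ite_eq',
        if_pos (Finset.HasAntidiagonal.mem_antidiagonal.2 hγ)]
      exact div_mul_cancel₀ _ (by positivity)
    obtain ⟨Q, hQ, hfQ⟩ := ih (hf.sub (contDiff_polyFun P)) fun γ hγ x hx => by
      have := congrFun (pderivIter_sub γ hf (contDiff_polyFun P)) x
      rw [Pi.sub_apply, hPder γ hγ, hconst γ hγ x hx, sub_self] at this
      exact this
    refine ⟨Q + P, add_mem (polyLT_mono n.le_succ hQ) hPmem, fun x hx => ?_⟩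
    have := hfQ x hx
    simp only [polyFun, map_add] at this ⊢
    linarith

/-- Polynomials agreeing almost everywhere on a nonempty open set are equal. -/
theorem eq_of_ae_eq_polyFun {U : Set Plane} (hU : IsOpen U) (hne : U.Nonempty)
    {P Q : MvPolynomial (Fin 2) ℝ} (h : ∀ᵐ x ∂(volume.restrict U), polyFun P x = polyFun Q x) :
    P = Q := by
  have heq : EqOn (polyFun P) (polyFun Q) U :=
    Measure.eqOn_open_of_ae_eq h hU (contDiff_polyFun P).continuous.continuousOn
      (contDiff_polyFun Q).continuous.continuousOn
  obtain ⟨c, hc⟩ := hne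
  -- In the sup norm a ball is a product of intervals, a grid of infinite sets on which a polynomial
  -- is determined by its values.
  have hV : IsOpen (WithLp.toLp 2 ⁻¹' U : Set (Fin 2 → ℝ)) :=
    hU.preimage (PiLp.continuous_toLp 2 _)
  obtain ⟨r, hr, hsub⟩ := Metric.isOpen_iff.1 hV (c.ofLp) (by simpa using hc)
  refine MvPolynomial.funext_set (fun i => Metric.ball (c i) r) (fun i => ?_) fun x hx => ?_
  · rw [Real.ball_eq_Ioo]
    exact Set.Ioo_infinite (by linarith)
  · have hx' : x ∈ Metric.ball c.ofLp r := by
      rw [ball_pi _ hr]; exact hx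
    exact heq (hsub hx')

/-- Almost everywhere limits of polynomials of bounded degree are such polynomials. -/
theorem exists_polyLT_of_tendsto {S : Set Plane} (n : ℕ) {f : ℕ → Plane → ℝ} {u : Plane → ℝ}
    (hf : ∀ k, ∃ P ∈ polyLT (n + 1), ∀ x ∈ S, f k x = polyFun P x)
    (hu : ∀ x ∈ S, Filter.Tendsto (fun k => f k x) Filter.atTop (nhds (u x))) :
    ∃ P ∈ polyLT (n + 1), ∀ x ∈ S, u x = polyFun P x := by
  let E : MvPolynomial (Fin 2) ℝ →ₗ[ℝ] (S → ℝ) :=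
    { toFun := fun P x => polyFun P x
      map_add' := fun P Q => by ext; simp [polyFun]
      map_smul' := fun c P => by ext; simp [polyFun] }
  have := finiteDimensional_polyLT n
  -- The product topology on `S → ℝ` is pointwise convergence, and a finite-dimensional subspace is
  -- closed in it.
  have hcl : IsClosed ((polyLT (n + 1)).map E : Set (S → ℝ)) :=
    Submodule.closed_of_finiteDimensional _
  have hmem : (fun x : S => u x) ∈ ((polyLT (n + 1)).map E : Set (S → ℝ)) := by
    refine hcl.mem_of_tendsto (f := fun (k : ℕ) (x : S) => f k x)
      (tendsto_pi_nhds.2 fun x => hu x x.2) (Filter.Eventually.of_forall fun k => ?_)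
    obtain ⟨P, hP, h⟩ := hf k
    exact ⟨P, hP, funext fun x => (h x x.2).symm⟩
  obtain ⟨P, hP, h⟩ := hmem
  exact ⟨P, hP, fun x hx => (congrFun h ⟨x, hx⟩).symm⟩

/-! ### Functions with vanishing weak derivatives -/

/-- Derivatives of order `n` are orthogonal to polynomials of degree less than `n`. -/
theorem integral_polyFun_mul_pderivIter {n : ℕ} {P : MvPolynomial (Fin 2) ℝ} (hP : P ∈ polyLT n)
    {γ : ℕ × ℕ} (hγ : γ.1 + γ.2 = n) {f : Plane → ℝ} (hf : ContDiff ℝ n f)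
    (hc : HasCompactSupport f) : ∫ x, polyFun P x * pderivIter γ f x = 0 := by
  induction n generalizing P γ with
  | zero => simp [polyLT_zero hP, polyFun]
  | succ n ih =>
    obtain ⟨i, δ, hδ, h⟩ := exists_pderivIter_eq hγ
    have hg : ContDiff ℝ (1 : ℕ) (pderivIter δ f) :=
      contDiff_pderivIter (k := 1) hδ (by rwa [add_comm])
    have hgc : HasCompactSupport (pderivIter δ f) := hasCompactSupport_pderivIter hc δ
    have hg'c : HasCompactSupport (pderiv i (pderivIter δ f)) := by
      rw [← h]; exact hasCompactSupport_pderivIter hc γ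
    have hg' : Continuous (pderiv i (pderivIter δ f)) :=
      (contDiff_pderiv (n := 0) hg i).continuous
    have hPc : ∀ Q, Continuous (polyFun Q) := fun Q => (contDiff_polyFun Q).continuous
    -- Moving the outermost derivative onto `P` lowers both the degree bound and the order by one.
    have hparts := integral_mul_fderiv_eq_neg_fderiv_mul_of_integrable (μ := volume)
      (f := polyFun P) (g := pderivIter δ f) (v := e i)
      (by
        change Integrable (fun x => pderiv i (polyFun P) x * pderivIter δ f x)
        rw [pderiv_polyFun]
        exact ((hPc _).mul hg.continuous).integrable_of_hasCompactSupport hgc.mul_left)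
      (((hPc P).mul hg').integrable_of_hasCompactSupport hg'c.mul_left)
      (((hPc P).mul hg.continuous).integrable_of_hasCompactSupport hgc.mul_left)
      (fun x _ => (contDiff_polyFun P).differentiable (by simp) x)
      (fun x _ => hg.differentiable (by simp) x)
    rw [h]
    refine hparts.trans ?_
    have hih := ih (pderiv_mem_polyLT hP i) hδ (hf.of_le (by norm_cast; omega))
    rw [← pderiv_polyFun] at hih
    exact neg_eq_zero.2 hih

open scoped Convolution in
/-- Partial derivatives of a convolution fall on the smooth factor. -/
theorem pderivIter_convolution {w g : Plane → ℝ} (hw : LocallyIntegrable w volume)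
    (hg : ContDiff ℝ ∞ g) (hc : HasCompactSupport g) (γ : ℕ × ℕ) :
    pderivIter γ (g ⋆[ContinuousLinearMap.lsmul ℝ ℝ, volume] w) =
      (pderivIter γ g) ⋆[ContinuousLinearMap.lsmul ℝ ℝ, volume] w := by
  have := pderivIter_comm_of (C := fun g => ContDiff ℝ ∞ g ∧ HasCompactSupport g)
    (fun i g hg => ⟨contDiff_infty_pderiv i g hg.1,
      hg.2.mono' ((subset_tsupport _).trans (tsupport_pderiv_subset i g))⟩)
    (fun g => g ⋆[ContinuousLinearMap.lsmul ℝ ℝ, volume] w) 1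
    (fun i g hg => ?_) (γ := γ) rfl ⟨hg, hc⟩
  · simpa using this
  · ext x
    have hd := hg.2.hasFDerivAt_convolution_left (ContinuousLinearMap.lsmul ℝ ℝ)
      (hg.1.of_le (by norm_cast)) hw x
    rw [one_smul, pderiv, hd.fderiv]
    have hex : ConvolutionExistsAt (fderiv ℝ g) w x
        ((ContinuousLinearMap.lsmul ℝ ℝ).precompL Plane) volume :=
      (hg.2.fderiv ℝ).convolutionExists_left _
        (hg.1.continuous_fderiv (by simp)) hw x
    rw [convolution_def, convolution_def, ContinuousLinearMap.integral_apply hex]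
    rfl

theorem pderivIter_comp_sub_left (x : Plane) {g : Plane → ℝ} (hg : ContDiff ℝ ∞ g) {n : ℕ}
    {γ : ℕ × ℕ} (hγ : γ.1 + γ.2 = n) :
    pderivIter γ (fun t => g (x - t)) = (-1 : ℝ) ^ n • fun t => pderivIter γ g (x - t) := by
  refine pderivIter_comm_of (C := ContDiff ℝ ∞) contDiff_infty_pderiv
    (fun g t => g (x - t)) (-1) (fun i g hg => ?_) hγ hg
  ext t
  have hd : HasFDerivAt (fun t => g (x - t))
      ((fderiv ℝ g (x - t)).comp (-ContinuousLinearMap.id ℝ Plane)) t :=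
    (hg.differentiable (by simp) (x - t)).hasFDerivAt.comp t ((hasFDerivAt_id t).const_sub x)
  simp [pderiv, hd.fderiv]

/-- The weak partial derivatives of order `n` of `w` vanish in `Ω`. -/
def WeakDerivZero (Ω : Set Plane) (n : ℕ) (w : Plane → ℝ) : Prop :=
  ∀ f : Plane → ℝ, ContDiff ℝ ∞ f → HasCompactSupport f → tsupport f ⊆ Ω →
    ∀ γ : ℕ × ℕ, γ.1 + γ.2 = n → ∫ x, w x * pderivIter γ f x = 0

open scoped Convolution in
-- Up to sign, the derivative of the convolution at `x` pairs `w` with the derivative of `t ↦ g (x -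
-- t)`, a test function supported in the `ε`-ball about `x`, hence in `Ω`.
theorem WeakDerivZero.pderivIter_convolution_eq_zero {Ω : Set Plane} {n : ℕ} {w : Plane → ℝ}
    (h : WeakDerivZero Ω n w) (hw : LocallyIntegrable w volume) {g : Plane → ℝ}
    (hg : ContDiff ℝ ∞ g) {ε : ℝ} (hgε : tsupport g ⊆ Metric.closedBall 0 ε) {x : Plane}
    (hx : Metric.closedBall x ε ⊆ Ω) {γ : ℕ × ℕ} (hγ : γ.1 + γ.2 = n) :
    pderivIter γ (g ⋆[ContinuousLinearMap.lsmul ℝ ℝ, volume] w) x = 0 := by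
  have hc : HasCompactSupport g :=
    (isCompact_closedBall (0 : Plane) ε).of_isClosed_subset (isClosed_tsupport g) hgε
  have hsupp : tsupport (fun t => g (x - t)) ⊆ Metric.closedBall x ε := by
    refine closure_minimal (fun t ht => ?_) Metric.isClosed_closedBall
    have := hgε (subset_tsupport g ht)
    rw [mem_closedBall_zero_iff] at this
    rwa [Metric.mem_closedBall, dist_comm, dist_eq_norm]
  have hz := h (fun t => g (x - t)) (hg.comp (contDiff_const.sub contDiff_id))
    ((isCompact_closedBall x ε).of_isClosed_subset (isClosed_tsupport _) hsupp)
    (hsupp.trans hx) γ hγ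
  rw [pderivIter_comp_sub_left x hg hγ] at hz
  rw [pderivIter_convolution hw hg hc, convolution_eq_swap]
  have hz' : (-1 : ℝ) ^ n * ∫ t, pderivIter γ g (x - t) * w t = 0 := by
    rw [← integral_const_mul, ← hz]
    congr 1
    ext t
    simp
    ring
  simpa using hz'

open scoped Convolution in
/-- A function whose weak derivatives of order `n + 1` vanish is locally a polynomial of degree at
most `n`. -/
theorem WeakDerivZero.exists_ball {Ω : Set Plane} (hΩ : IsOpen Ω) {n : ℕ} {w : Plane → ℝ}
    (h : WeakDerivZero Ω (n + 1) w) (hw : LocallyIntegrable w volume) {x : Plane} (hx : x ∈ Ω) :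
    ∃ r > 0, ∃ P ∈ polyLT (n + 1),
      ∀ᵐ y ∂(volume.restrict (Metric.ball x r)), w y = polyFun P y := by
  obtain ⟨R, hR, hsub⟩ := Metric.isOpen_iff.1 hΩ x hx
  have hr : 0 < R / 2 := by positivity
  -- Outer radii below `R / 2` keep the mollified values on `ball x (R / 2)` dependent on `ball x R`
  -- only; the fixed ratio 2 of the radii is what almost everywhere convergence requires.
  let bump : ℕ → ContDiffBump (0 : Plane) := fun k =>
    { rIn := R / 2 / (k + 2) / 2
      rOut := R / 2 / (k + 2)
      rIn_pos := by positivity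
      rIn_lt_rOut := half_lt_self (by positivity) }
  have hout : ∀ k, (bump k).rOut = R / 2 / ((k + 2 : ℕ) : ℝ) := fun k => by simp [bump]
  have hlim : Filter.Tendsto (fun k => (bump k).rOut) Filter.atTop (nhds 0) := by
    simp_rw [hout]
    exact (tendsto_const_div_atTop_nhds_zero_nat (R / 2)).comp (Filter.tendsto_add_atTop_nat 2)
  have hlt : ∀ k, (bump k).rOut < R / 2 := fun k => by
    rw [hout]
    exact div_lt_self hr (by norm_cast; omega)
  have hae := ContDiffBump.ae_convolution_tendsto_right_of_locallyIntegrable (μ := volume)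
    (K := 2) hlim (Filter.Eventually.of_forall fun k => by simp [bump]; linarith) hw
  set S : Set Plane := {y | y ∈ Metric.ball x (R / 2) ∧ Filter.Tendsto
    (fun k => ((bump k).normed volume ⋆[ContinuousLinearMap.lsmul ℝ ℝ, volume] w) y)
    Filter.atTop (nhds (w y))} with hS
  obtain ⟨P, hP, hwP⟩ := exists_polyLT_of_tendsto (S := S) n (u := w)
    (f := fun k => (bump k).normed volume ⋆[ContinuousLinearMap.lsmul ℝ ℝ, volume] w)
    (fun k => by
      obtain ⟨P, hP, hfP⟩ := exists_polyLT_of_pderivIter_eq_zero x (R / 2) hr (n + 1)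
        (f := (bump k).normed volume ⋆[ContinuousLinearMap.lsmul ℝ ℝ, volume] w)
        ((bump k).hasCompactSupport_normed.contDiff_convolution_left _ (bump k).contDiff_normed hw)
        (fun γ hγ y hy => h.pderivIter_convolution_eq_zero hw (bump k).contDiff_normed
          (bump k).tsupport_normed_eq.subset
          (fun z hz => hsub (by
            rw [Metric.mem_closedBall] at hz
            rw [Metric.mem_ball] at hy ⊢
            have := dist_triangle z y x
            have := hlt k
            linarith)) hγ)
      exact ⟨P, hP, fun y hy => hfP y hy.1⟩)
    (fun y hy => hy.2)
  refine ⟨R / 2, hr, P, hP, ?_⟩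
  rw [ae_restrict_iff' Metric.isOpen_ball.measurableSet]
  filter_upwards [hae] with y hy hy'
  exact hwP y ⟨hy', hy⟩

/-- A function on a connected open set whose weak derivatives of order `n + 1` vanish is a
polynomial of degree at most `n`. -/
theorem WeakDerivZero.exists_polyLT {Ω : Set Plane} (hΩ : IsOpen Ω) (hconn : IsConnected Ω) {n : ℕ}
    {w : Plane → ℝ} (h : WeakDerivZero Ω (n + 1) w) (hw : LocallyIntegrable w volume) :
    ∃ P ∈ polyLT (n + 1), ∀ᵐ y ∂(volume.restrict Ω), w y = polyFun P y := by
  -- Outside `Ω` the radius and polynomial are dummies, so that `choose` yields functions on the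
  -- whole plane.
  have hloc : ∀ x : Plane, ∃ r > 0, ∃ P ∈ polyLT (n + 1), x ∈ Ω →
      ∀ᵐ y ∂(volume.restrict (Metric.ball x r)), w y = polyFun P y := fun x => by
    by_cases hx : x ∈ Ω
    · obtain ⟨r, hr, P, hP, h⟩ := h.exists_ball hΩ hw hx
      exact ⟨r, hr, P, hP, fun _ => h⟩
    · exact ⟨1, one_pos, 0, zero_mem _, fun h => absurd h hx⟩
  choose r hr Q hQ hwQ using hloc
  obtain ⟨x₀, hx₀⟩ := hconn.nonempty
  have hconst : ∀ x ∈ Ω, Q x₀ = Q x := fun x hx => by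
    refine hconn.isPreconnected.induction₂ (fun x y => Q x = Q y) (fun y hy => ?_)
      (fun _ _ _ _ _ _ h1 h2 => h1.trans h2) (fun _ _ _ _ h => h.symm) hx₀ hx
    filter_upwards [self_mem_nhdsWithin, nhdsWithin_le_nhds (Metric.ball_mem_nhds y (hr y))]
      with z hz hzy
    -- The two balls overlap: `z` lies in the ball about `y` and is the centre of its own.
    refine eq_of_ae_eq_polyFun (Metric.isOpen_ball.inter Metric.isOpen_ball)
      ⟨z, hzy, Metric.mem_ball_self (hr z)⟩ ?_
    filter_upwards [ae_restrict_of_ae_restrict_of_subset inter_subset_left (hwQ y hy),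
      ae_restrict_of_ae_restrict_of_subset inter_subset_right (hwQ z hz)] with t h1 h2
    exact h1.symm.trans h2
  refine ⟨Q x₀, hQ x₀, ?_⟩
  rw [ae_restrict_iff' hΩ.measurableSet, ae_iff]
  refine measure_null_of_locally_null _ fun x hx => ?_
  have hxΩ : x ∈ Ω := by
    by_contra hc
    exact hx fun h => absurd h hc
  refine ⟨_, inter_mem_nhdsWithin _ (Metric.ball_mem_nhds x (hr x)), ?_⟩
  have hball := hwQ x hxΩ
  rw [ae_restrict_iff' Metric.isOpen_ball.measurableSet, ae_iff] at hball
  refine measure_mono_null (fun y hy => ?_) hball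
  intro hy'
  refine hy.1 fun _ => ?_
  rw [hconst x hxΩ]
  exact hy' hy.2

/-! ### Test fields concentrated on one component -/

theorem ofComp_apply_basis (m : ℕ) (c : ℕ × ℕ → ℝ) (q : Fin m → Fin 2) :
    (ofComp m c).1 (fun i => e (q i)) = c (countIndex q) := by
  have hprod : ∀ p : Fin m → Fin 2, ∏ i, (e (q i) : Plane) (p i) = if p = q then 1 else 0 := by
    intro p
    split_ifs with h
    · subst h; simp [e]
    · obtain ⟨i, hi⟩ := Function.ne_iff.1 h
      exact Finset.prod_eq_zero (Finset.mem_univ i) (by simp [e, hi])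
  simp only [ofComp, sum_apply, smul_apply, ContinuousMultilinearMap.compContinuousLinearMap_apply,
    ContinuousMultilinearMap.mkPiAlgebra_apply, PiLp.proj_apply, smul_eq_mul, hprod]
  simp

theorem comp_ofComp {m : ℕ} (c : ℕ × ℕ → ℝ) {β : ℕ × ℕ} (hβ : β.1 + β.2 = m) :
    comp (ofComp m c) β = c β := by
  have h := ofComp_apply_basis m c (fun i => if (i : ℕ) < β.1 then 0 else 1)
  have hcount : countIndex (fun i : Fin m => if (i : ℕ) < β.1 then (0 : Fin 2) else 1) = β := by
    have h0 : (Finset.univ.filter fun i : Fin m => (i : ℕ) < β.1).card = β.1 := by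
      rw [Fin.card_filter_val_lt]; omega
    have h1 := Finset.card_filter_add_card_filter_not (s := (Finset.univ : Finset (Fin m)))
      (fun i => (i : ℕ) < β.1)
    rw [h0, Finset.card_univ, Fintype.card_fin] at h1
    refine Prod.ext ?_ ?_
    · simpa [countIndex] using h0
    · simp only [countIndex, ite_eq_right_iff, zero_ne_one, imp_false]
      omega
  rw [hcount] at h
  rw [← h, comp]
  congr 1
  ext1 i
  split_ifs <;> rfl

/-- A tensor with small components belongs to the dilated ellipse. -/
theorem ofComp_mem_smul_tensorEllipse {a θ : ℝ} (ha : 0 < a) (ha' : a ≤ 1) {r : ℝ} (hr : 0 < r)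
    {m : ℕ} {c : ℕ × ℕ → ℝ} (hc : ∀ q : Fin m → Fin 2, |c (countIndex q)| ≤ r * (a / 3)) :
    ofComp m c ∈ r • tensorEllipse a θ m := by
  rw [Set.mem_smul_set_iff_inv_smul_mem₀ hr.ne']
  intro i p
  have hval : ∀ k : Fin 2, |(r⁻¹ • ofComp m c).1 (Function.update (fun j => e (p j)) i (e k))| ≤
      a / 3 := by
    intro k
    have hupd : Function.update (fun j => e (p j)) i (e k) =
        fun j => e (Function.update p i k j) := by
      ext1 j
      by_cases h : j = i
      · subst h; simp
      · simp [h]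
    have : (r⁻¹ • ofComp m c).1 (Function.update (fun j => e (p j)) i (e k)) =
        r⁻¹ * c (countIndex (Function.update p i k)) := by
      rw [hupd, ← ofComp_apply_basis m c]
      rfl
    rw [this, abs_mul, abs_of_pos (inv_pos.2 hr), inv_mul_le_iff₀ hr]
    exact hc _
  have h0 := hval 0
  have h1 := hval 1
  generalize (r⁻¹ • ofComp m c).1 (Function.update (fun j => e (p j)) i (e 0)) = v at h0 ⊢
  generalize (r⁻¹ • ofComp m c).1 (Function.update (fun j => e (p j)) i (e 1)) = w at h1 ⊢
  -- Both rotated coordinates are at most `2a/3`. Since `a ≤ 1`, each normalized square is at most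
  -- `4/9`, and `8/9 ≤ 1`; this is why the bound `a/3` suffices.
  have hs : ∀ s t : ℝ, |s| ≤ 1 → |t| ≤ 1 → |v * s + w * t| ≤ 2 * a / 3 := by
    intro s t hs ht
    calc |v * s + w * t| ≤ |v * s| + |w * t| := abs_add_le _ _
      _ = |v| * |s| + |w| * |t| := by rw [abs_mul, abs_mul]
      _ ≤ a / 3 * 1 + a / 3 * 1 := by gcongr
      _ = 2 * a / 3 := by ring
  have hA := hs _ _ (Real.abs_cos_le_one θ) (Real.abs_sin_le_one θ)
  have hB := hs (-Real.sin θ) _ (by rw [abs_neg]; exact Real.abs_sin_le_one θ)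
    (Real.abs_cos_le_one θ)
  have hA' : (v * Real.cos θ + w * Real.sin θ) ^ 2 ≤ 4 / 9 := by
    rw [← sq_abs]
    have : |v * Real.cos θ + w * Real.sin θ| ≤ 2 / 3 := by linarith
    calc _ ≤ (2 / 3 : ℝ) ^ 2 := by gcongr
      _ = _ := by norm_num
  have hB' : ((-v * Real.sin θ + w * Real.cos θ) / a) ^ 2 ≤ 4 / 9 := by
    rw [← sq_abs, abs_div, abs_of_pos ha]
    have : |-v * Real.sin θ + w * Real.cos θ| / a ≤ 2 / 3 := by
      rw [div_le_iff₀ ha, neg_mul, ← mul_neg]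
      linarith
    calc _ ≤ (2 / 3 : ℝ) ^ 2 := by gcongr
      _ = _ := by norm_num
  simp only [ellipse, Set.mem_ofPred_eq, div_one]
  change (v * Real.cos θ + w * Real.sin θ) ^ 2 +
    ((-v * Real.sin θ + w * Real.cos θ) / a) ^ 2 ≤ 1
  linarith

/-- The symmetric tensor whose only nonvanishing component is the one of index `γ`. -/
noncomputable def unitTensor (h : ℕ) (γ : ℕ × ℕ) : SymTensor h :=
  ofComp h fun β => if β = γ then 1 else 0

theorem divComp_smul_tensor {h : ℕ} (l : ℕ) (f : Plane → ℝ) (T : SymTensor h) (β : ℕ × ℕ)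
    (x : Plane) : divComp l (fun y => f y • T) β x =
      ∑ γ ∈ Finset.HasAntidiagonal.antidiagonal l, ((l ! : ℝ) / ((γ.1 ! : ℝ) * (γ.2 ! : ℝ))) *
        (comp T (β + γ) * pderivIter γ f x) := by
  refine Finset.sum_congr rfl fun γ _ => ?_
  have : (fun y => comp (f y • T) (β + γ)) = comp T (β + γ) • f := by
    ext y
    exact mul_comm (f y) (comp T (β + γ))
  rw [this, pderivIter_const_smul]
  rfl

/-- Only the summand of index `γ` survives, so a single partial derivative of order `h` is isolated.
-/
theorem divComp_unitTensor {h : ℕ} {γ : ℕ × ℕ} (hγ : γ.1 + γ.2 = h) (f : Plane → ℝ) (x : Plane) :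
    divComp h (fun y => f y • unitTensor h γ) (0, 0) x =
      (h ! : ℝ) / ((γ.1 ! : ℝ) * (γ.2 ! : ℝ)) * pderivIter γ f x := by
  rw [divComp_smul_tensor, Finset.sum_eq_single γ]
  · rw [← Prod.zero_eq_mk, zero_add, unitTensor, comp_ofComp _ hγ]
    simp
  · intro δ hδ hne
    rw [← Prod.zero_eq_mk, zero_add, unitTensor,
      comp_ofComp _ (Finset.HasAntidiagonal.mem_antidiagonal.1 hδ), if_neg hne]
    simp
  · exact fun hn => absurd (Finset.HasAntidiagonal.mem_antidiagonal.2 hγ) hn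

theorem exists_bound_pderivIter {f : Plane → ℝ} (hf : ContDiff ℝ ∞ f) (hc : HasCompactSupport f)
    (γ : ℕ × ℕ) : ∃ M, ∀ x, |pderivIter γ f x| ≤ M :=
  (hasCompactSupport_pderivIter hc γ).exists_bound_of_continuous
    (contDiff_infty_pderivIter hf γ).continuous

theorem contDiff_smul_tensor {h : ℕ} {n : WithTop ℕ∞} (T : SymTensor h) :
    ContDiff ℝ n fun s : ℝ => s • T := by
  refine (IsLinearMap.with_bound (f := fun s : ℝ => s • T)
    ⟨fun s t => add_smul s t T, fun c s => mul_smul c s T⟩ ‖T‖ fun s => ?_).contDiff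
  rw [mul_comm]
  exact (norm_smul s T.1).le

theorem contDiff_apply_tensor {h : ℕ} {n : WithTop ℕ∞} (v : Fin h → Plane) :
    ContDiff ℝ n fun ξ : SymTensor h => ξ.1 v := by
  refine (IsLinearMap.with_bound (f := fun ξ : SymTensor h => ξ.1 v)
    ⟨fun _ _ => rfl, fun _ _ => rfl⟩ (∏ i, ‖v i‖) fun ξ => ?_).contDiff
  rw [mul_comm]
  exact ξ.1.le_opNorm v

/-- Small multiples of a smooth compactly supported tensor field are feasible. -/
theorem eventually_smul_mem_feasible {Ω : Set Plane} {a θ : ℝ} (ha : 0 < a) (ha' : a ≤ 1) {h : ℕ}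
    {lam : Fin h → ℝ} (hlam : ∀ l, 0 < lam l) {f : Plane → ℝ} (hf : ContDiff ℝ ∞ f)
    (hc : HasCompactSupport f) (hs : tsupport f ⊆ Ω) (T : SymTensor h) :
    ∀ᶠ t in nhds (0 : ℝ), (fun y => (t • f) y • T) ∈ feasible Ω a θ lam := by
  have hbound : ∀ (l : Fin h) (β : ℕ × ℕ),
      ∀ᶠ t in nhds (0 : ℝ), ∀ x, |divComp l (fun y => (t • f) y • T) β x| ≤ lam l * (a / 3) := by
    intro l β
    choose M hM using exists_bound_pderivIter hf hc
    -- The divergence scales linearly in `t`, so `|t| * K` bounds it uniformly in `x`.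
    set K : ℝ := ∑ γ ∈ Finset.HasAntidiagonal.antidiagonal (l : ℕ),
      |((l : ℕ) ! : ℝ) / ((γ.1 ! : ℝ) * (γ.2 ! : ℝ))| * (|comp T (β + γ)| * M γ) with hK
    have hpos : 0 < lam l * (a / 3) := mul_pos (hlam l) (by positivity)
    have hlim : Filter.Tendsto (fun t : ℝ => |t| * K) (nhds 0) (nhds 0) := by
      have : Continuous fun t : ℝ => |t| * K := by fun_prop
      simpa using this.tendsto 0
    filter_upwards [hlim.eventually_lt_const hpos] with t ht x
    refine le_trans ?_ ht.le
    rw [divComp_smul_tensor, hK, Finset.mul_sum]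
    refine (Finset.abs_sum_le_sum_abs _ _).trans (Finset.sum_le_sum fun γ _ => ?_)
    rw [pderivIter_const_smul, Pi.smul_apply, smul_eq_mul, abs_mul, abs_mul, abs_mul,
      show ∀ A B C D : ℝ, A * (B * (C * D)) = C * (A * (B * D)) by intros; ring]
    gcongr
    exact hM γ x
  -- There are finitely many pairs `(l, q)`, so one neighbourhood of 0 serves them all.
  have hall : ∀ᶠ t in nhds (0 : ℝ), ∀ (l : Fin h) (q : Fin (h - l) → Fin 2), ∀ x,
      |divComp l (fun y => (t • f) y • T) (countIndex q) x| ≤ lam l * (a / 3) :=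
    Filter.eventually_all.2 fun l => Filter.eventually_all.2 fun q => hbound l _
  filter_upwards [hall] with t ht
  have hsupp : tsupport (fun y => (t • f) y • T) ⊆ tsupport f :=
    closure_mono fun y hy hfy => hy (by simp [hfy])
  refine ⟨?_, hc.of_isClosed_subset (isClosed_tsupport _) hsupp, hsupp.trans hs, fun x _ l =>
    ofComp_mem_smul_tensorEllipse ha ha' (hlam l) fun q => ht l q x⟩
  exact (contDiff_smul_tensor T).comp
    ((contDiff_const.smul hf).of_le (m := h) (by exact_mod_cast le_top))

/-! ### The kernel of the directional total generalized variation -/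

theorem weakDerivZero_of_dtgv_eq_zero {Ω : Set Plane} (hΩ : IsOpen Ω) {a θ : ℝ} (ha : 0 < a)
    (ha' : a ≤ 1) {h : ℕ} {lam : Fin h → ℝ} (hlam : ∀ l, 0 < lam l) {u : Plane → ℝ}
    (hu : dtgv Ω a θ lam u = 0) : WeakDerivZero Ω h (Ω.indicator u) := by
  intro f hf hc hs γ hγ
  obtain ⟨ε, hε, hball⟩ := Metric.eventually_nhds_iff.1
    (eventually_smul_mem_feasible (θ := θ) ha ha' hlam hf hc hs (unitTensor h γ))
  have hind : ∫ x, Ω.indicator u x * pderivIter γ f x = ∫ x in Ω, u x * pderivIter γ f x := by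
    rw [← integral_indicator hΩ.measurableSet]
    congr 1
    ext x
    rw [Set.indicator_mul_left]
  set I := ∫ x in Ω, u x * pderivIter γ f x with hI
  set κ : ℝ := (h ! : ℝ) / ((γ.1 ! : ℝ) * (γ.2 ! : ℝ)) with hκ
  have hκpos : 0 < κ := by positivity
  -- Each small `t` gives a feasible field with integral `t κ I`, bounded by the supremum 0; `t =
  -- ±ε/2` then forces `I = 0`.
  have hle : ∀ t : ℝ, |t| < ε → t * (κ * I) ≤ 0 := by
    intro t ht
    have hmem := hball (y := t) (by simpa using ht)
    have hsup := le_iSup₂ (f := fun η (_ : η ∈ feasible Ω a θ lam) =>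
      ((∫ x in Ω, u x * divComp h η (0, 0) x : ℝ) : EReal)) _ hmem
    have hsup' := hsup.trans_eq hu
    have hval : ∫ x in Ω, u x * divComp h (fun y => (t • f) y • unitTensor h γ) (0, 0) x =
        t * (κ * I) := by
      rw [hI, ← integral_const_mul, ← integral_const_mul]
      congr 1
      ext x
      rw [divComp_unitTensor hγ, pderivIter_const_smul, Pi.smul_apply, smul_eq_mul]
      ring
    rw [hval] at hsup'
    exact_mod_cast hsup'
  have h1 := hle (ε / 2) (by rw [abs_of_pos (by positivity)]; linarith)
  have h2 := hle (-(ε / 2)) (by rw [abs_neg, abs_of_pos (by positivity)]; linarith)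
  have h3 : ε / 2 * (κ * I) = 0 := by linarith
  rw [hind]
  simpa [hε.ne', hκpos.ne'] using h3

theorem contDiff_comp_field {h : ℕ} {η : Plane → SymTensor h} {n : WithTop ℕ∞}
    (hη : ContDiff ℝ n η) (β : ℕ × ℕ) : ContDiff ℝ n fun y => comp (η y) β :=
  (contDiff_apply_tensor _).comp hη

theorem tsupport_comp_field_subset {h : ℕ} (η : Plane → SymTensor h) (β : ℕ × ℕ) :
    tsupport (fun y => comp (η y) β) ⊆ tsupport η :=
  closure_mono fun y hy hηy => hy (by simp [hηy, comp])

/-- Every term of the `h`-fold divergence is an order-`h` derivative of a compactly supported `C^h`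
function, hence orthogonal to `P`. The support lies in `Ω`, so the integral may be taken over the
plane. -/
theorem integral_mul_divComp_eq_zero {Ω : Set Plane} {h : ℕ}
    {η : Plane → SymTensor h} (hη : ContDiff ℝ h η) (hc : HasCompactSupport η)
    (hs : tsupport η ⊆ Ω) {P : MvPolynomial (Fin 2) ℝ} (hP : P ∈ polyLT h) {u : Plane → ℝ}
    (hu : ∀ᵐ x ∂(volume.restrict Ω), u x = polyFun P x) :
    ∫ x in Ω, u x * divComp h η (0, 0) x = 0 := by
  have hcomp : ∀ β, HasCompactSupport fun y => comp (η y) β := fun β =>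
    hc.of_isClosed_subset (isClosed_tsupport _) (tsupport_comp_field_subset η β)
  have hzero : ∀ x ∉ Ω, ∀ γ β, pderivIter γ (fun y => comp (η y) β) x = 0 := fun x hx γ β =>
    image_eq_zero_of_notMem_tsupport fun hmem =>
      hx (hs (tsupport_comp_field_subset η β (tsupport_pderivIter_subset _ _ hmem)))
  have hcongr : ∫ x in Ω, u x * divComp h η (0, 0) x =
      ∫ x in Ω, polyFun P x * divComp h η (0, 0) x := by
    refine integral_congr_ae ?_
    filter_upwards [hu] with x hx
    rw [hx]
  rw [hcongr, setIntegral_eq_integral_of_forall_compl_eq_zero fun x hx => by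
    simp [divComp, hzero x hx]]
  simp_rw [divComp, Finset.mul_sum]
  have hterm : ∀ γ ∈ Finset.HasAntidiagonal.antidiagonal h,
      Continuous (pderivIter γ fun y => comp (η y) ((0, 0) + γ)) := fun γ hγ =>
    (contDiff_pderivIter (k := 0) (Finset.HasAntidiagonal.mem_antidiagonal.1 hγ)
      (by simpa using contDiff_comp_field hη _)).continuous
  rw [integral_finsetSum _ fun γ hγ => ?_]
  · refine Finset.sum_eq_zero fun γ hγ => ?_
    simp_rw [mul_left_comm (polyFun P _)]
    rw [integral_const_mul, integral_polyFun_mul_pderivIter hP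
      (Finset.HasAntidiagonal.mem_antidiagonal.1 hγ) (contDiff_comp_field hη _) (hcomp _), mul_zero]
  · exact ((contDiff_polyFun P).continuous.mul (continuous_const.mul
      (hterm γ hγ))).integrable_of_hasCompactSupport
        ((hasCompactSupport_pderivIter (hcomp _) γ).mul_left.mul_left)

end DTGV

theorem mainTheorem4 (Ω : Set DTGV.Plane) (hΩ_open : IsOpen Ω) (hΩ_conn : IsConnected Ω)
    (a θ : ℝ) (ha_pos : 0 < a) (ha_le : a ≤ 1)
    (h : ℕ) (hh : 1 ≤ h) (lam : Fin h → ℝ) (hlam : ∀ l, 0 < lam l)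
    (u : DTGV.Plane → ℝ) (hu : IntegrableOn u Ω volume) :
    DTGV.dtgv Ω a θ lam u = 0 ↔
      ∃ P : MvPolynomial (Fin 2) ℝ, P.totalDegree < h ∧
        ∀ᵐ x ∂(volume.restrict Ω), u x = MvPolynomial.eval (fun i => x i) P := by
  -- For `h ≥ 1`, `totalDegree < h` is membership in `polyLT h`; at `h = 0` the zero polynomial, of
  -- `totalDegree` 0, would break this.
  obtain ⟨n, rfl⟩ : ∃ n, h = n + 1 := ⟨h - 1, by omega⟩
  constructor
  · intro hzero
    obtain ⟨P, hP, hwP⟩ :=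
      (DTGV.weakDerivZero_of_dtgv_eq_zero hΩ_open ha_pos ha_le hlam hzero).exists_polyLT hΩ_open
        hΩ_conn (hu.integrable_indicator hΩ_open.measurableSet).locallyIntegrable
    refine ⟨P, Nat.lt_succ_of_le (DTGV.mem_polyLT_succ_iff.1 hP), ?_⟩
    filter_upwards [hwP, ae_restrict_mem hΩ_open.measurableSet] with x hx hxΩ
    rwa [Set.indicator_of_mem hxΩ] at hx
  · rintro ⟨P, hP, huP⟩
    have hP' : P ∈ DTGV.polyLT (n + 1) := DTGV.mem_polyLT_succ_iff.2 (Nat.le_of_lt_succ hP)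
    have hint : ∀ η ∈ DTGV.feasible Ω a θ lam,
        ∫ x in Ω, u x * DTGV.divComp (n + 1) η (0, 0) x = 0 := fun η hη =>
      DTGV.integral_mul_divComp_eq_zero hη.1 hη.2.1 hη.2.2.1 hP' huP
    -- The zero field is feasible. Without a feasible field the supremum in `EReal` would be `⊥`
    -- instead of 0.
    have hne := (DTGV.eventually_smul_mem_feasible (Ω := Ω) (θ := θ) ha_pos ha_le hlam
      (f := fun _ => 0) contDiff_const HasCompactSupport.zero (by simp) 0).self_of_nhds
    refine le_antisymm (iSup₂_le fun η hη => by rw [hint η hη]; simp) ?_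
    refine le_trans ?_ (le_iSup₂ (f := fun η (_ : η ∈ DTGV.feasible Ω a θ lam) =>
      ((∫ x in Ω, u x * DTGV.divComp (n + 1) η (0, 0) x : ℝ) : EReal)) _ hne)
    simp only [hint _ hne]
    simp
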